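/- Let $\mathfrak b$ denote the least cardinality of a family $F\subseteq\omega^\omega$ for which there is no $g\in\omega^\omega$ such that, for every $f\in F$, $f(n)\le g(n)$ for all but finitely many $n$. The $\pi$-weight of a topological space $X$ is the least cardinality of a $\pi$-base of $X$, that is, of a family of nonempty open sets such that every nonempty open subset of $X$ contains a member of the family. A space $X$ is Fréchet–Urysohn if every point in the closure of a set $A\subseteq X$ is the limit of a sequence of points of $A$; it is zero-dimensional if its clopen sets form a base; and it is H-separable if for every sequence $(D_n)_{n\in\omega}$ of dense subsets of $X$ there are finite sets $F_n\subseteq D_n$ $(n\in\omega)$ such that $\bigcup_{n\in A}F_n$ is dense in $X$ for every infinite $A\subseteq\omega$. Suppose that $\mathfrak c=2^{\aleph_0}\le\omega_2$. Then there is a countable Hausdorff zero-dimensional Fréchet–Urysohn space that is not H-separable and has $\pi$-weight $\mathfrak b$. -/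

import Mathlib

open Set Filter TopologicalSpace

open scoped Cardinal

/-- A family `F` of functions `ℕ → ℕ` is unbounded modulo finite: no single `g` satisfies
`f n ≤ g n` for all but finitely many `n`, for every `f ∈ F`. -/
def UnboundedModFinite (F : Set (ℕ → ℕ)) : Prop :=
  ¬ ∃ g : ℕ → ℕ, ∀ f ∈ F, ∀ᶠ n in atTop, f n ≤ g n

/-- The bounding number `𝔟`: the least cardinality of a subfamily of `ℕ → ℕ` that is
unbounded modulo finite. -/
noncomputable def boundingNumber : Cardinal.{0} :=
  sInf {κ : Cardinal.{0} | ∃ F : Set (ℕ → ℕ), UnboundedModFinite F ∧ #F = κ}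

universe u

/-- `P` is a π-base of `X`: a family of nonempty open sets such that every nonempty open set
contains a member of the family. -/
def IsPiBase (X : Type u) [TopologicalSpace X] (P : Set (Set X)) : Prop :=
  (∀ U ∈ P, IsOpen U ∧ U.Nonempty) ∧
    ∀ W : Set X, IsOpen W → W.Nonempty → ∃ U ∈ P, U ⊆ W

/-- The π-weight: the least cardinality of a π-base. -/
noncomputable def piWeight (X : Type u) [TopologicalSpace X] : Cardinal.{u} :=
  sInf {κ : Cardinal.{u} | ∃ P : Set (Set X), IsPiBase X P ∧ #P = κ}

/-- Zero-dimensional: the clopen sets form a base of the topology. -/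
def IsZeroDimensional (X : Type u) [TopologicalSpace X] : Prop :=
  IsTopologicalBasis {s : Set X | IsClopen s}

/-- H-separable: from every sequence of dense sets `D n` one can select finite sets
`F n ⊆ D n` such that `⋃ n ∈ A, F n` is dense for every infinite `A ⊆ ℕ`. -/
def HSeparable (X : Type u) [TopologicalSpace X] : Prop :=
  ∀ D : ℕ → Set X, (∀ n, Dense (D n)) →
    ∃ F : ℕ → Set X, (∀ n, (F n).Finite ∧ F n ⊆ D n) ∧
      ∀ A : Set ℕ, A.Infinite → Dense (⋃ n ∈ A, F n)

open scoped Topology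

/-! ### The bounding number -/

/-! Since ℵ₁ ≤ 𝔟 ≤ 𝔠 ≤ ℵ₂, either 𝔟 = ℵ₁ or 𝔟 = 𝔠, and each case gets its own countable space with a
clopen subbase of at most 𝔟 sets. That size bounds the π-weight from above; the lower bound comes
with the failure of H-separability, by `hSeparable_of_piWeight_lt`. By `clopenTopology_spec` it
remains to make closure points sequential limits, and to find dense sets `D n` such that every
finite selection from them is missed, for infinitely many `n`, by a nonempty subbasic set.

If 𝔟 = 𝔠, refine the bitwise topology on `ℕ` in 𝔠 steps, keeping a list of sets and a list of
sequences that must stay convergent. Before each step both lists are shorter than 𝔟, so a point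
outside `A` either is the limit of a sequence in `A` or can be separated from `A` by a new set
respecting all listed sequences (`exists_separating_or_sequence`). The dense sets are the columns.
Almost disjoint branches index infinitely many columns each; some branch is exceptional for no
listed sequence, so a new set can avoid a given selection along it (`exists_set_above`).

If 𝔟 = ℵ₁, the space is `Finset ℕ`, with subbasic sets `avoiding (e t)` for a tower `e` of length ω₁
whose gaps outgrow an unbounded family. The dense sets fix the column of the maximum. Sequences come
from a closing-off argument (`exists_convergent_sequence`): the stages below some δ < ω₁ are handled
by enumeration, and all later ones at once, because the tower members from δ on inherit the gaps of
`e δ`. -/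

theorem exists_unboundedModFinite_card_eq :
    ∃ F : Set (ℕ → ℕ), UnboundedModFinite F ∧ #F = boundingNumber := by
  refine csInf_mem (s := {κ : Cardinal.{0} | ∃ F : Set (ℕ → ℕ), UnboundedModFinite F ∧ #F = κ})
    ⟨_, univ, ?_, rfl⟩
  rintro ⟨g, hg⟩
  obtain ⟨n, hn⟩ := (hg (fun n => g n + 1) (mem_univ _)).exists
  omega

theorem boundingNumber_le_continuum : boundingNumber ≤ 𝔠 := by
  obtain ⟨F, -, hF⟩ := exists_unboundedModFinite_card_eq
  rw [← hF]
  refine (Cardinal.mk_set_le F).trans ?_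
  simp

theorem exists_eventually_le_of_card_lt {ι : Type} (f : ι → ℕ → ℕ) (h : #ι < boundingNumber) :
    ∃ g : ℕ → ℕ, StrictMono g ∧ ∀ i, ∀ᶠ n in atTop, f i n ≤ g n := by
  have h1 : ¬ UnboundedModFinite (range f) := fun hu =>
    (lt_of_le_of_lt Cardinal.mk_range_le h).not_ge (csInf_le' ⟨_, hu, rfl⟩)
  obtain ⟨g, hg⟩ := not_not.1 h1
  refine ⟨fun n => (∑ k ∈ Finset.range (n + 1), g k) + n, strictMono_nat_of_lt_succ fun n => ?_,
    fun i => ?_⟩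
  · rw [Finset.sum_range_succ _ (n + 1)]
    omega
  · filter_upwards [hg _ (mem_range_self i)] with n hn
    rw [Finset.sum_range_succ]
    omega

theorem exists_eventually_le_of_countable {ι : Type} [Countable ι] (f : ι → ℕ → ℕ) :
    ∃ g : ℕ → ℕ, ∀ i, ∀ᶠ n in atTop, f i n ≤ g n := by
  classical
  obtain ⟨e, he⟩ := exists_injective_nat ι
  have hfin : ∀ n, {i | e i ≤ n}.Finite := fun n =>
    (Set.finite_Iic n).preimage he.injOn
  refine ⟨fun n => ∑ i ∈ (hfin n).toFinset, f i n, fun i => ?_⟩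
  filter_upwards [eventually_ge_atTop (e i)] with n hn
  exact Finset.single_le_sum (f := fun i => f i n) (fun _ _ => Nat.zero_le _) (by simpa using hn)

theorem aleph0_lt_boundingNumber : ℵ₀ < boundingNumber := by
  obtain ⟨F, hF, hc⟩ := exists_unboundedModFinite_card_eq
  by_contra! h
  rw [← hc, Cardinal.mk_le_aleph0_iff] at h
  obtain ⟨g, hg⟩ := exists_eventually_le_of_countable (fun f : F => (f : ℕ → ℕ))
  exact hF ⟨g, fun f hf => hg ⟨f, hf⟩⟩

/-! ### π-weight and H-separability of countable spaces -/

theorem exists_isPiBase_card_eq (X : Type) [TopologicalSpace X] :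
    ∃ P : Set (Set X), IsPiBase X P ∧ #P = piWeight X := by
  refine csInf_mem (s := {κ : Cardinal.{0} | ∃ P : Set (Set X), IsPiBase X P ∧ #P = κ})
    ⟨_, {U | IsOpen U ∧ U.Nonempty}, ⟨fun _ h => h, fun W h1 h2 => ⟨W, ⟨h1, h2⟩, subset_rfl⟩⟩, rfl⟩

/-- A countable space of π-weight less than `𝔟` is H-separable. -/
theorem hSeparable_of_piWeight_lt (X : Type) [TopologicalSpace X] [Countable X]
    (h : piWeight X < boundingNumber) : HSeparable X := by
  obtain ⟨P, hP, hc⟩ := exists_isPiBase_card_eq X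
  intro D hD
  obtain ⟨e, he⟩ := exists_injective_nat X
  have hx : ∀ (U : P) (n : ℕ), ∃ x, x ∈ (U : Set X) ∧ x ∈ D n := fun U n => by
    obtain ⟨x, h1, h2⟩ := (hD n).inter_open_nonempty _ (hP.1 U U.2).1 (hP.1 U U.2).2
    exact ⟨x, h1, h2⟩
  choose x hxU hxD using hx
  -- One `g` eventually bounds the codes of the chosen points for every member of the π-base, so the
  -- points of `D n` with code at most `g n` form a suitable selection.
  obtain ⟨g, -, hg⟩ := exists_eventually_le_of_card_lt (fun U n => e (x U n)) (by rwa [hc])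
  refine ⟨fun n => {y ∈ D n | e y ≤ g n}, fun n => ⟨?_, sep_subset _ _⟩, fun A hA => ?_⟩
  · exact ((Set.finite_Iic (g n)).preimage he.injOn).subset fun y hy => hy.2
  · rw [dense_iff_inter_open]
    intro W hW hne
    obtain ⟨U, hU, hUW⟩ := hP.2 W hW hne
    obtain ⟨n, hn, hnA⟩ :=
      ((hg ⟨U, hU⟩).and_frequently (Nat.frequently_atTop_iff_infinite.2 hA)).exists
    exact ⟨x ⟨U, hU⟩ n, hUW (hxU ⟨U, hU⟩ n), mem_iUnion₂.2 ⟨n, hnA, hxD _ n, hn⟩⟩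

/-! ### Topologies with a prescribed clopen subbase -/

section Cylinders

variable {X : Type}

/-- The points that lie in the same members of `Γ` as `x`. -/
def cylinder (Γ : Finset (Set X)) (x : X) : Set X := {a | ∀ U ∈ Γ, (a ∈ U ↔ x ∈ U)}

/-- The sequence `s` converges to `x` with respect to every `U ∈ 𝒰` and its complement. -/
def ConvergesOn (𝒰 : Set (Set X)) (x : X) (s : ℕ → X) : Prop :=
  ∀ U ∈ 𝒰, ∀ᶠ n in atTop, (s n ∈ U ↔ x ∈ U)

/-- The topology in which the members of `𝒰` and their complements form a subbase. -/
@[reducible]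
def clopenTopology (𝒰 : Set (Set X)) : TopologicalSpace X where
  IsOpen W := ∀ x ∈ W, ∃ Γ : Finset (Set X), ↑Γ ⊆ 𝒰 ∧ cylinder Γ x ⊆ W
  isOpen_univ := fun _ _ => ⟨∅, by simp, subset_univ _⟩
  isOpen_inter := by
    classical
    rintro V W hV hW x ⟨hxV, hxW⟩
    obtain ⟨Γ, h1, h2⟩ := hV x hxV
    obtain ⟨Δ, h3, h4⟩ := hW x hxW
    refine ⟨Γ ∪ Δ, by simp [h1, h3], fun a ha => ⟨h2 fun U hU => ?_, h4 fun U hU => ?_⟩⟩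
    · exact ha U (Finset.mem_union_left _ hU)
    · exact ha U (Finset.mem_union_right _ hU)
  isOpen_sUnion := by
    rintro S hS x ⟨W, hWS, hxW⟩
    obtain ⟨Γ, h1, h2⟩ := hS W hWS x hxW
    exact ⟨Γ, h1, h2.trans (subset_sUnion_of_mem hWS)⟩

theorem mem_cylinder_self (Γ : Finset (Set X)) (x : X) : x ∈ cylinder Γ x := fun _ _ => Iff.rfl

theorem isOpen_clopenTopology {𝒰 : Set (Set X)} {W : Set X} : IsOpen[clopenTopology 𝒰] W ↔
    ∀ x ∈ W, ∃ Γ : Finset (Set X), ↑Γ ⊆ 𝒰 ∧ cylinder Γ x ⊆ W := Iff.rfl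

theorem isClopen_cylinder {𝒰 : Set (Set X)} {Γ : Finset (Set X)} (hΓ : ↑Γ ⊆ 𝒰) (x : X) :
    @IsClopen _ (clopenTopology 𝒰) (cylinder Γ x) := by
  let _ := clopenTopology 𝒰
  refine ⟨isOpen_compl_iff.1 (isOpen_clopenTopology.2 fun a ha =>
      ⟨Γ, hΓ, fun b hb hbx => ha fun U hU => ?_⟩),
    isOpen_clopenTopology.2 fun a ha => ⟨Γ, hΓ, fun b hb U hU => ?_⟩⟩
  · exact (hb U hU).symm.trans (hbx U hU)
  · exact (hb U hU).trans (ha U hU)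

theorem tendsto_clopenTopology {𝒰 : Set (Set X)} {x : X} {s : ℕ → X} (h : ConvergesOn 𝒰 x s) :
    Tendsto s atTop (@nhds _ (clopenTopology 𝒰) x) := by
  let _ := clopenTopology 𝒰
  intro W hW
  obtain ⟨V, hVW, hV, hx⟩ := mem_nhds_iff.1 hW
  obtain ⟨Γ, hΓ, hΓV⟩ := isOpen_clopenTopology.1 hV x hx
  have h1 : ∀ᶠ n in atTop, ∀ U ∈ Γ, (s n ∈ U ↔ x ∈ U) :=
    (Filter.eventually_all_finset Γ).2 fun U hU => h U (hΓ hU)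
  exact h1.mono fun n hn => hVW (hΓV hn)

/-- Combinatorial criterion for the clopen topology of a family of at most `𝔟` sets to be a
Fréchet–Urysohn space that is not H-separable and has π-weight `𝔟`. -/
theorem clopenTopology_spec [Countable X] (𝒰 : Set (Set X)) (hcard : #𝒰 ≤ boundingNumber)
    (hsep : ∀ x y, (∀ U ∈ 𝒰, (x ∈ U ↔ y ∈ U)) → x = y)
    (hFU : ∀ (x : X) (A : Set X),
      (∀ Γ : Finset (Set X), ↑Γ ⊆ 𝒰 → ∃ a ∈ A, a ∈ cylinder Γ x) →
      ∃ s : ℕ → X, (∀ n, s n ∈ A) ∧ ConvergesOn 𝒰 x s)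
    (D : ℕ → Set X) (hD : ∀ n x, ∃ s : ℕ → X, (∀ k, s k ∈ D n) ∧ ConvergesOn 𝒰 x s)
    (hH : ∀ F : ℕ → Set X, (∀ n, (F n).Finite ∧ F n ⊆ D n) →
      ∃ U ∈ 𝒰, U.Nonempty ∧ ∃ A : Set ℕ, A.Infinite ∧ ∀ n ∈ A, Disjoint (F n) U) :
    ∃ _ : TopologicalSpace X,
      Countable X ∧ T2Space X ∧ IsZeroDimensional X ∧ FrechetUrysohnSpace X ∧
        ¬ HSeparable X ∧ piWeight X = boundingNumber := by
  let _ := clopenTopology 𝒰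
  have hnot : ¬ HSeparable X := by
    intro h
    obtain ⟨F, hF, hdense⟩ := h D fun n x => by
      obtain ⟨s, hs, hsx⟩ := hD n x
      exact mem_closure_of_tendsto (tendsto_clopenTopology hsx) (.of_forall hs)
    obtain ⟨U, hU, hne, A, hA, hdis⟩ := hH F hF
    have hUo : IsOpen U := isOpen_clopenTopology.2 fun x hx =>
      ⟨{U}, by simpa using hU, fun a ha => (ha U (by simp)).2 hx⟩
    obtain ⟨a, haU, ha⟩ := (hdense A hA).inter_open_nonempty U hUo hne
    obtain ⟨n, hn, han⟩ := mem_iUnion₂.1 ha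
    exact (hdis n hn).ne_of_mem han haU rfl
  refine ⟨‹_›, ‹_›, ⟨fun x y hxy => ?_⟩, ?_, ⟨fun A x hx => ?_⟩, hnot, le_antisymm ?_ ?_⟩
  · by_contra! hcon
    obtain ⟨U, hU, hxU⟩ : ∃ U ∈ 𝒰, ¬ (x ∈ U ↔ y ∈ U) := by
      by_contra! h
      exact hxy (hsep x y h)
    have hΓ : ((({U} : Finset (Set X)) : Set (Set X))) ⊆ 𝒰 := by simpa using hU
    refine hcon _ _ (isClopen_cylinder hΓ x).isOpen (isClopen_cylinder hΓ y).isOpen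
      (mem_cylinder_self _ x) (mem_cylinder_self _ y) (disjoint_left.2 fun a h1 h2 => hxU ?_)
    exact (h1 U (by simp)).symm.trans (h2 U (by simp))
  · refine isTopologicalBasis_of_isOpen_of_nhds (fun u hu => hu.isOpen) fun a W ha hW => ?_
    obtain ⟨Γ, hΓ, hΓW⟩ := isOpen_clopenTopology.1 hW a ha
    exact ⟨_, isClopen_cylinder hΓ a, mem_cylinder_self _ a, hΓW⟩
  · obtain ⟨s, hs, hsx⟩ := hFU x A fun Γ hΓ => by
      obtain ⟨a, ha, haA⟩ := mem_closure_iff.1 hx _ (isClopen_cylinder hΓ x).isOpen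
        (mem_cylinder_self Γ x)
      exact ⟨a, haA, ha⟩
    exact ⟨s, hs, tendsto_clopenTopology hsx⟩
  · classical
    let P : Set (Set X) :=
      range fun q : X × Finset 𝒰 => cylinder (q.2.map (Function.Embedding.subtype _)) q.1
    have hsub : ∀ Γ : Finset 𝒰,
        ((Γ.map (Function.Embedding.subtype _) : Finset (Set X)) : Set (Set X)) ⊆ 𝒰 := by
      intro Γ U hU
      simp only [Finset.coe_map, mem_image] at hU
      obtain ⟨V, -, rfl⟩ := hU
      exact V.2
    have hP : IsPiBase X P := by
      refine ⟨?_, fun W hW ⟨x, hx⟩ => ?_⟩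
      · rintro _ ⟨⟨x, Γ⟩, rfl⟩
        exact ⟨(isClopen_cylinder (hsub Γ) x).isOpen, x, mem_cylinder_self _ x⟩
      · obtain ⟨Γ, hΓ, hΓW⟩ := isOpen_clopenTopology.1 hW x hx
        refine ⟨_, ⟨⟨x, Γ.subtype (· ∈ 𝒰)⟩, rfl⟩, ?_⟩
        intro a ha
        refine hΓW fun U hU => ha U ?_
        simp only [Finset.mem_map, Finset.mem_subtype]
        exact ⟨⟨U, hΓ hU⟩, hU, rfl⟩
    have h0 : ℵ₀ ≤ boundingNumber := aleph0_lt_boundingNumber.le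
    calc piWeight X ≤ #P := csInf_le' ⟨P, hP, rfl⟩
      _ ≤ #(X × Finset 𝒰) := Cardinal.mk_range_le
      _ = #X * #(Finset 𝒰) := by simp
      _ ≤ boundingNumber * boundingNumber := by
        gcongr
        · exact (Cardinal.mk_le_aleph0 (α := X)).trans h0
        · rcases finite_or_infinite 𝒰 with hf | hi
          · exact (Cardinal.lt_aleph0_of_finite _).le.trans h0
          · rwa [Cardinal.mk_finset_of_infinite]
      _ = boundingNumber := Cardinal.mul_eq_self h0
  · by_contra! h
    exact hnot (hSeparable_of_piWeight_lt X h)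

end Cylinders

/-! ### Transfinite choice -/

/-- Along a well-order, a choice that is always possible in accordance with the earlier choices
can be made throughout. -/
theorem exists_transfinite_choice {ι α : Type} [LinearOrder ι] [WellFoundedLT ι] [Nonempty α]
    (R : α → α → Prop) (Good : ι → α → Prop)
    (h : ∀ (t : ι) (a : ι → α), (∀ s < t, Good s (a s)) → (∀ s < t, ∀ r < s, R (a r) (a s)) →
      ∃ b, Good t b ∧ ∀ s < t, R (a s) b) :
    ∃ a : ι → α, (∀ t, Good t (a t)) ∧ ∀ t, ∀ s < t, R (a s) (a t) := by
  classical
  let Q : (t : ι) → (ι → α) → α → Prop := fun t a b => Good t b ∧ ∀ s < t, R (a s) b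
  let ext : (t : ι) → ((s : ι) → s < t → α) → ι → α := fun t f s =>
    -- The default value is harmless: `Q t` looks only at indices below `t`.
    if hs : s < t then f s hs else Classical.arbitrary α
  let step : (t : ι) → ((s : ι) → s < t → α) → α := fun t f =>
    Classical.epsilon (Q t (ext t f))
  let a : ι → α := (wellFounded_lt (α := ι)).fix step
  have ha : ∀ t, a t = Classical.epsilon (Q t (ext t fun s _ => a s)) := fun t =>
    WellFounded.fix_eq _ _ _
  have hQ : ∀ t (b : α), Q t (ext t fun s _ => a s) b ↔ Q t a b := by
    intro t b
    refine and_congr_right fun _ => forall₂_congr fun s hs => ?_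
    simp [ext, hs]
  have key : ∀ t, Q t a (a t) := by
    intro t
    induction t using WellFoundedLT.induction with
    | ind t ih =>
      have h1 := h t a (fun s hs => (ih s hs).1) (fun s hs => (ih s hs).2)
      rw [← hQ, ha t]
      exact Classical.epsilon_spec (p := Q t (ext t fun s _ => a s))
        (h1.imp fun b hb => (hQ t b).2 hb)
  exact ⟨a, fun t => (key t).1, fun t => (key t).2⟩

/-! ### Separating points from sequentially closed sets -/

/-- Numbers up to `j` are below `2 ^ j`, so all their higher bits vanish. -/
theorem eq_of_testBit_eq_of_le {i j : ℕ} (hij : i ≤ j)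
    (h : ∀ l < j + 1, i.testBit l = j.testBit l) : i = j := by
  refine Nat.eq_of_testBit_eq fun l => ?_
  rcases lt_or_ge l (j + 1) with hl | hl
  · exact h l hl
  · have h2 : j < 2 ^ l := (Nat.lt_two_pow_self (n := j)).trans_le
      (Nat.pow_le_pow_right (by norm_num) (by omega))
    rw [Nat.testBit_lt_two_pow h2, Nat.testBit_lt_two_pow (hij.trans_lt h2)]

/-- Fewer than `𝔟` sequences converging bitwise admit a common slow rate of convergence. -/
theorem exists_slow_rate {ι : Type} (hι : #ι < boundingNumber) (y : ι → ℕ) (s : ι → ℕ → ℕ)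
    (hconv : ∀ i l, ∀ᶠ n in atTop, (s i n).testBit l = (y i).testBit l) :
    ∃ m : ℕ → ℕ, Tendsto m atTop atTop ∧
      ∀ i, ∀ᶠ n in atTop, ∀ l < m (s i n), (s i n).testBit l = (y i).testBit l := by
  have hconv' : ∀ i k, ∀ᶠ n in atTop, ∀ l < k, (s i n).testBit l = (y i).testBit l := fun i k =>
    ((Set.finite_Iio k).eventually_all (l := atTop)).2 fun l _ => hconv i l
  choose N hN using fun i k => eventually_atTop.1 (hconv' i k)
  -- The sum exceeds every term `s i n` with `n < N i k`. Hence, once `g` dominates it at `k`, `g k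
  -- ≤ s i n` forces `N i k ≤ n`.
  obtain ⟨g, hgm, hg⟩ := exists_eventually_le_of_card_lt
    (fun i k => ∑ n ∈ Finset.range (N i k), (s i n + 1)) hι
  refine ⟨fun j => Nat.findGreatest (fun k => g k ≤ j) j, ?_, fun i => ?_⟩
  · refine tendsto_atTop.2 fun k => ?_
    filter_upwards [eventually_ge_atTop (g k)] with j hj
    exact Nat.le_findGreatest ((hgm.le_apply).trans hj) hj
  · obtain ⟨k₀, hk₀⟩ := eventually_atTop.1 (hg i)
    filter_upwards [hconv' i k₀] with n hn
    set m := Nat.findGreatest (fun k => g k ≤ s i n) (s i n) with hm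
    rcases le_or_gt m k₀ with h | h
    · exact fun l hl => hn l (hl.trans_le h)
    · have hgm' : g m ≤ s i n :=
        Nat.findGreatest_of_ne_zero (P := fun k => g k ≤ s i n) hm.symm (by omega)
      by_contra hcon
      have hlt : n < N i m := by
        by_contra! hle
        exact hcon (hN i m n hle)
      have h1 : s i n + 1 ≤ ∑ n ∈ Finset.range (N i m), (s i n + 1) :=
        Finset.single_le_sum (f := fun n => s i n + 1) (fun _ _ => Nat.zero_le _)
          (Finset.mem_range.2 hlt)
      have h2 := hk₀ m h.le
      omega

/-- A slow common rate of convergence lets each number guess a parent, which along each sequence is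
eventually the limit. Membership in `W` is then inherited from parents, except that points of `C`
are refused. -/
theorem exists_separating_set {ι : Type} (hι : #ι < boundingNumber) (y : ι → ℕ) (s : ι → ℕ → ℕ)
    (hs : ∀ i, StrictMono (s i))
    (hconv : ∀ i l, ∀ᶠ n in atTop, (s i n).testBit l = (y i).testBit l) {C : Set ℕ} {x : ℕ}
    (hx : x ∉ C) (hC : ∀ i, y i ∉ C → ∀ᶠ n in atTop, s i n ∉ C) :
    ∃ W : Set ℕ, x ∈ W ∧ Disjoint W C ∧ ∀ i, ∀ᶠ n in atTop, (s i n ∈ W ↔ y i ∈ W) := by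
  classical
  obtain ⟨m, hm, hmy⟩ := exists_slow_rate hι y s hconv
  have hex : ∀ j, ∃ i : ℕ, ∀ l < m j, j.testBit l = i.testBit l := fun j => ⟨j, fun _ _ => rfl⟩
  let par : ℕ → ℕ := fun j => Nat.find (hex j)
  have hpary : ∀ i, ∀ᶠ n in atTop, par (s i n) = y i := by
    intro i
    filter_upwards [hmy i, (hm.comp (hs i).tendsto_atTop).eventually_ge_atTop (y i + 1)]
      with n hn hn2
    refine (Nat.find_eq_iff (hex (s i n))).2 ⟨hn, fun j hj hcon => hj.ne ?_⟩
    refine eq_of_testBit_eq_of_le hj.le fun l hl => ?_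
    have hl' : l < m (s i n) := hl.trans_le hn2
    rw [← hcon l hl', hn l hl']
  -- The guard `par j < j` makes the recursion well founded. It costs nothing along a sequence,
  -- whose terms eventually exceed their limit.
  let f : ℕ → Prop := fun j => Nat.strongRec (motive := fun _ => Prop)
    (fun j ih => j = x ∨ (j ∉ C ∧ ∃ h : par j < j, ih (par j) h)) j
  have hf : ∀ j, f j ↔ (j = x ∨ (j ∉ C ∧ par j < j ∧ f (par j))) := by
    intro j
    have h1 : f j = (j = x ∨ (j ∉ C ∧ ∃ _ : par j < j, f (par j))) := by
      simp only [f]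
      rw [Nat.strongRec]
    rw [h1]
    simp only [exists_prop]
  refine ⟨{j | f j}, (hf x).2 (Or.inl rfl), disjoint_left.2 fun j hj hjC => ?_, fun i => ?_⟩
  · rcases (hf j).1 hj with rfl | h
    · exact hx hjC
    · exact h.1 hjC
  · have hlarge := (hs i).tendsto_atTop.eventually_gt_atTop (max x (y i))
    by_cases hy : y i ∈ C
    · have hyf : ¬ f (y i) := by
        intro h
        rcases (hf _).1 h with h | h
        · exact hx (h ▸ hy)
        · exact h.1 hy
      filter_upwards [hpary i, hlarge] with n h1 h2
      refine iff_of_false (fun h => ?_) hyf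
      rcases (hf _).1 h with h | h
      · have := le_max_left x (y i)
        omega
      · rw [h1] at h
        exact hyf h.2.2
    · filter_upwards [hpary i, hlarge, hC i hy] with n h1 h2 h3
      rw [hf (s i n), h1]
      have h4 := le_max_left x (y i)
      have h5 := le_max_right x (y i)
      constructor
      · rintro (h | h)
        · omega
        · exact h.2.2
      · exact fun h => Or.inr ⟨h3, by omega, h⟩

/-! ### Columns and branches -/

/-- The column of `x`, determined by the leading binary digit of `x`. -/
def column (x : ℕ) : ℕ := (Nat.unpair (Nat.log2 x)).1

/-- A sequence in column `c` that converges bitwise to `x`. -/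
def columnSeq (x c n : ℕ) : ℕ := 2 ^ Nat.pair c (n + x) + x

theorem lt_two_pow_pair (x c n : ℕ) : x < 2 ^ Nat.pair c (n + x) :=
  (Nat.lt_two_pow_self (n := x)).trans_le <| Nat.pow_le_pow_right (by norm_num) <|
    (Nat.le_add_left x n).trans (Nat.right_le_pair _ _)

theorem column_columnSeq (x c n : ℕ) : column (columnSeq x c n) = c := by
  have h := lt_two_pow_pair x c n
  have h1 : Nat.log2 (columnSeq x c n) = Nat.pair c (n + x) := by
    unfold columnSeq
    rw [Nat.log2_eq_iff (by omega), pow_succ]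
    omega
  rw [column, h1, Nat.unpair_pair]

theorem strictMono_columnSeq (x c : ℕ) : StrictMono (columnSeq x c) := fun a b hab => by
  have : 2 ^ Nat.pair c (a + x) < 2 ^ Nat.pair c (b + x) :=
    Nat.pow_lt_pow_right (by norm_num) (Nat.pair_lt_pair_right _ (by omega))
  unfold columnSeq
  omega

theorem testBit_columnSeq (x c l : ℕ) :
    ∀ᶠ n in atTop, (columnSeq x c n).testBit l = x.testBit l := by
  filter_upwards [eventually_gt_atTop l] with n hn
  refine Nat.testBit_two_pow_add_gt ?_ x
  have := Nat.right_le_pair c (n + x)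
  omega

/-- Codes of the initial segments of `y`. -/
def branch (y : ℕ → Bool) : Set ℕ :=
  range fun k : ℕ => Encodable.encode (List.ofFn fun i : Fin k => y i)

theorem infinite_branch (y : ℕ → Bool) : (branch y).Infinite := by
  refine infinite_range_of_injective fun a b hab => ?_
  simpa using congrArg List.length (Encodable.encode_injective hab)

theorem finite_branch_inter {y z : ℕ → Bool} (h : y ≠ z) : (branch y ∩ branch z).Finite := by
  obtain ⟨l, hl⟩ := Function.ne_iff.1 h
  refine ((Set.finite_Iic l).image
    fun k : ℕ => Encodable.encode (List.ofFn fun i : Fin k => y i)).subset ?_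
  rintro _ ⟨⟨k, rfl⟩, ⟨k', hk'⟩⟩
  refine ⟨k, ?_, rfl⟩
  have h1 := Encodable.encode_injective hk'
  have h2 : k' = k := by simpa using congrArg List.length h1
  subst h2
  rw [List.ofFn_inj] at h1
  by_contra! hk
  rw [mem_Iic, not_le] at hk
  exact hl (congrFun h1 ⟨l, hk⟩).symm

/-- With at most one exception, branches have only small intersection with the sequence. -/
def IsBranchThin (s : ℕ → ℕ) : Prop :=
  ∃ y₀ : ℕ → Bool, ∀ y ≠ y₀, ∀ g : ℕ → ℕ,
    ∀ᶠ n in atTop, ¬ (column (s n) ∈ branch y ∧ s n ≤ g (column (s n)))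

theorem isBranchThin_of_column_eq {s : ℕ → ℕ} (hs : StrictMono s) {c : ℕ}
    (h : ∀ n, column (s n) = c) : IsBranchThin s := by
  refine ⟨fun _ => true, fun y _ g => ?_⟩
  filter_upwards [hs.tendsto_atTop.eventually_gt_atTop (g c)] with n hn h2
  rw [h] at h2
  omega

/-- Pass to a subsequence inside one column if possible, where the terms outgrow any bound `g c`;
failing that, inside the columns of one branch, which any other branch meets in a finite set. If
neither exists, every branch is eventually left. -/
theorem exists_subseq_isBranchThin {s : ℕ → ℕ} (hs : StrictMono s) :
    ∃ φ : ℕ → ℕ, StrictMono φ ∧ IsBranchThin (s ∘ φ) := by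
  by_cases h : ∃ c, ∃ᶠ n in atTop, column (s n) = c
  · obtain ⟨c, hc⟩ := h
    obtain ⟨φ, hφ, h1⟩ := extraction_of_frequently_atTop hc
    exact ⟨φ, hφ, isBranchThin_of_column_eq (hs.comp hφ) h1⟩
  simp only [not_exists, not_frequently] at h
  by_cases h2 : ∃ y, ∃ᶠ n in atTop, column (s n) ∈ branch y
  · obtain ⟨y₀, hy₀⟩ := h2
    obtain ⟨φ, hφ, h1⟩ := extraction_of_frequently_atTop hy₀
    refine ⟨φ, hφ, y₀, fun y hy g => ?_⟩
    have h3 : ∀ᶠ n in atTop, ∀ c ∈ branch y ∩ branch y₀, ¬ column (s n) = c :=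
      (finite_branch_inter hy).eventually_all.2 fun c _ => h c
    filter_upwards [hφ.tendsto_atTop.eventually h3] with n hn hcon
    exact hn _ ⟨hcon.1, h1 n⟩ rfl
  · simp only [not_exists, not_frequently] at h2
    refine ⟨id, strictMono_id, fun _ => true, fun y _ g => ?_⟩
    filter_upwards [h2 y] with n hn hcon using hn hcon.1

/-! ### Extending a partial topology by one step -/

section Step

variable {𝒰 : Set (Set ℕ)} {𝒮 : Set (ℕ × (ℕ → ℕ))}

/-- A point outside a set can be separated from it, or is the limit of a sequence in it. -/
theorem exists_separating_or_sequence (h𝒰 : #𝒰 < boundingNumber) (h𝒮 : #𝒮 < boundingNumber)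
    (hbit : ∀ l, {z : ℕ | z.testBit l} ∈ 𝒰) (hmono : ∀ q ∈ 𝒮, StrictMono q.2)
    (hcomp : ∀ q ∈ 𝒮, ConvergesOn 𝒰 q.1 q.2) {x : ℕ} {A : Set ℕ} (hxA : x ∉ A) :
    (∃ W : Set ℕ, x ∈ W ∧ Disjoint W A ∧ ∀ q ∈ 𝒮, ∀ᶠ n in atTop, (q.2 n ∈ W ↔ q.1 ∈ W)) ∨
    ∃ s : ℕ → ℕ, StrictMono s ∧ IsBranchThin s ∧ ConvergesOn 𝒰 x s ∧ ∀ n, s n ∈ A := by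
  have hbits : ∀ {z : ℕ} {s : ℕ → ℕ}, ConvergesOn 𝒰 z s → ∀ l,
      ∀ᶠ n in atTop, (s n).testBit l = z.testBit l := by
    intro z s h l
    filter_upwards [h _ (hbit l)] with n hn
    exact Bool.eq_iff_iff.2 hn
  -- `C` is the set of limits of sequences in `A`. It is closed under limits of the sequences in
  -- `𝒮`, as `exists_separating_set` requires.
  let C : Set ℕ := {z | ∃ r : ℕ → ℕ, (∀ n, r n ∈ A) ∧ ConvergesOn 𝒰 z r}
  have hAC : A ⊆ C := fun z hz => ⟨fun _ => z, fun _ => hz, fun _ _ => .of_forall fun _ => Iff.rfl⟩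
  by_cases hx : x ∈ C
  · right
    obtain ⟨r, hrA, hr⟩ := hx
    have hinf : Tendsto r atTop atTop := by
      refine tendsto_atTop.2 fun K => ?_
      have h1 : ∀ᶠ n in atTop, ∀ v ∈ Iio K, r n ≠ v := by
        refine (Set.finite_Iio K).eventually_all.2 fun v _ => ?_
        by_cases hv : v = x
        · exact .of_forall fun n hn => hxA (hv ▸ hn ▸ hrA n)
        · obtain ⟨l, hl⟩ := Nat.exists_testBit_ne_of_ne hv
          filter_upwards [hbits hr l] with n hn hnv
          exact hl (hnv ▸ hn)
      filter_upwards [h1] with n hn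
      by_contra! hlt
      exact hn _ hlt rfl
    obtain ⟨φ, hφ, hmφ⟩ := strictMono_subseq_of_tendsto_atTop hinf
    obtain ⟨ψ, hψ, hthin⟩ := exists_subseq_isBranchThin hmφ
    exact ⟨_, hmφ.comp hψ, hthin,
      fun U hU => (hφ.comp hψ).tendsto_atTop.eventually (hr U hU), fun n => hrA _⟩
  · left
    have hC : ∀ q : 𝒮, q.1.1 ∉ C → ∀ᶠ n in atTop, q.1.2 n ∉ C := by
      rintro ⟨⟨z, s⟩, hq⟩ hz
      by_contra hfreq
      simp only [not_eventually, not_not] at hfreq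
      obtain ⟨φ, hφ, hφC⟩ := extraction_of_frequently_atTop hfreq
      choose r hrA hr using hφC
      choose N hN using fun (U : 𝒰) n => eventually_atTop.1 (hr n U U.2)
      -- One `g` dominates the fewer than 𝔟 moduli of convergence, so the diagonal `r n (g n)`
      -- converges to `z`.
      obtain ⟨g, -, hg⟩ := exists_eventually_le_of_card_lt N h𝒰
      refine hz ⟨fun n => r n (g n), fun n => hrA _ _, fun U hU => ?_⟩
      filter_upwards [hg ⟨U, hU⟩, hφ.tendsto_atTop.eventually (hcomp _ hq U hU)] with n h1 h2
      exact (hN ⟨U, hU⟩ n _ h1).trans h2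
    obtain ⟨W, hxW, hWC, hW⟩ := exists_separating_set (ι := 𝒮) h𝒮 (fun q => q.1.1)
      (fun q => q.1.2) (fun q => hmono q q.2) (fun q => hbits (hcomp q q.2)) hx hC
    exact ⟨W, hxW, hWC.mono_right hAC, fun q hq => hW ⟨q, hq⟩⟩

/-- Fewer than 𝔠 sequences rule out fewer than 𝔠 branches. For a remaining branch `y`, every
sequence eventually leaves the region under `g` along `y`, so a point can be separated from that
region. -/
theorem exists_set_above (h𝒮 : #𝒮 < boundingNumber)
    (hmono : ∀ q ∈ 𝒮, StrictMono q.2) (hthin : ∀ q ∈ 𝒮, IsBranchThin q.2)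
    (hbits : ∀ q ∈ 𝒮, ∀ l, ∀ᶠ n in atTop, (q.2 n).testBit l = q.1.testBit l) (g : ℕ → ℕ) :
    ∃ W : Set ℕ, W.Nonempty ∧ (∃ y, ∀ z ∈ W, column z ∈ branch y → g (column z) < z) ∧
      ∀ q ∈ 𝒮, ∀ᶠ n in atTop, (q.2 n ∈ W ↔ q.1 ∈ W) := by
  choose y₀ hy₀ using fun q : 𝒮 => hthin q q.2
  obtain ⟨y, hy⟩ : ∃ y, y ∉ range y₀ := by
    by_contra! hcon
    have h1 : 𝔠 ≤ #𝒮 := by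
      have := Cardinal.mk_le_of_surjective (f := y₀) hcon
      simpa using this
    exact (h1.trans_lt h𝒮).not_ge boundingNumber_le_continuum
  let C : Set ℕ := {z | column z ∈ branch y ∧ z ≤ g (column z)}
  -- Any point above `g` in its own column would do; this one lies in column `0`.
  obtain ⟨n, hn⟩ := ((strictMono_columnSeq 0 0).tendsto_atTop.eventually_gt_atTop (g 0)).exists
  obtain ⟨W, hxW, hWC, hW⟩ := exists_separating_set (ι := 𝒮) h𝒮 (fun q => q.1.1)
    (fun q => q.1.2) (fun q => hmono q q.2) (fun q => hbits q q.2) (C := C)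
    (x := columnSeq 0 0 n) (fun h => by
      have := h.2
      rw [column_columnSeq] at this
      omega) fun q _ => hy₀ q y (fun h => hy ⟨q, h.symm⟩) g
  refine ⟨W, ⟨_, hxW⟩, ⟨y, fun z hz hzy => ?_⟩, fun q hq => hW ⟨q, hq⟩⟩
  by_contra! hle
  exact disjoint_left.1 hWC hz ⟨hzy, hle⟩

end Step

/-! ### The construction for `𝔟 = 𝔠` -/

/-- A step of the construction adds a clopen set or a convergent sequence with its limit. -/
abbrev Addition : Type := Set ℕ ⊕ (ℕ × (ℕ → ℕ))

/-- The sequence converges with respect to the clopen set. -/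
def Respects (U : Set ℕ) (q : ℕ × (ℕ → ℕ)) : Prop := ∀ᶠ n in atTop, (q.2 n ∈ U ↔ q.1 ∈ U)

def Addition.Compatible : Addition → Addition → Prop
  | .inl U, .inr q => Respects U q
  | .inr q, .inl U => Respects U q
  | _, _ => True

/-- Compatibility with the bitwise topology and with the sequences that make columns dense. -/
def Addition.Admissible : Addition → Prop
  | .inl U => ∀ x c, Respects U (x, columnSeq x c)
  | .inr q => StrictMono q.2 ∧ IsBranchThin q.2 ∧ ∀ l, Respects {z | z.testBit l} q

/-- A task is to separate a point from a set unless there is a convergent sequence, or to find an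
open set above a given function. -/
def Addition.Settles : (ℕ × Set ℕ) ⊕ (ℕ → ℕ) → Addition → Prop
  | .inl t, a => t.1 ∈ t.2 ∨ (∃ U, a = .inl U ∧ t.1 ∈ U ∧ Disjoint U t.2) ∨
      ∃ s : ℕ → ℕ, a = .inr (t.1, s) ∧ ∀ n, s n ∈ t.2
  | .inr g, a => ∃ U : Set ℕ, a = .inl U ∧ U.Nonempty ∧
      ∃ y, ∀ z ∈ U, column z ∈ branch y → g (column z) < z

theorem respects_testBit_columnSeq (x c l : ℕ) :
    Respects {z | z.testBit l} (x, columnSeq x c) := by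
  filter_upwards [testBit_columnSeq x c l] with n hn
  simp [hn]

/-- The successor step of the recursion. The bit sets and column sequences are adjoined to the
earlier additions; being countably many, they keep both families smaller than 𝔟. -/
theorem exists_addition {κ : Type} (hκ : #κ < boundingNumber) (a : κ → Addition)
    (hadm : ∀ k, (a k).Admissible) (hcomp : ∀ k k', (a k).Compatible (a k'))
    (t : (ℕ × Set ℕ) ⊕ (ℕ → ℕ)) :
    ∃ b : Addition, (b.Admissible ∧ b.Settles t) ∧ ∀ k, (a k).Compatible b := by
  have h0 := aleph0_lt_boundingNumber
  let 𝒰 : Set (Set ℕ) := {U | ∃ k, a k = .inl U} ∪ range fun l => {z : ℕ | z.testBit l}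
  let 𝒮 : Set (ℕ × (ℕ → ℕ)) :=
    {q | ∃ k, a k = .inr q} ∪ range fun p : ℕ × ℕ => (p.1, columnSeq p.1 p.2)
  have hinj : ∀ {β : Type} (f : β → Addition), Function.Injective f →
      #{v | ∃ k, a k = f v} ≤ #κ := by
    intro β f hf
    choose k hk using fun v : {v | ∃ k, a k = f v} => v.2
    refine Cardinal.mk_le_of_injective (f := k) fun v w hvw => Subtype.ext (hf ?_)
    rw [← hk, ← hk, hvw]
  have h𝒰 : #𝒰 < boundingNumber :=
    (Cardinal.mk_union_le _ _).trans_lt <| Cardinal.add_lt_of_lt h0.le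
      ((hinj _ Sum.inl_injective).trans_lt hκ)
      (((Set.countable_range _).le_aleph0).trans_lt h0)
  have h𝒮 : #𝒮 < boundingNumber :=
    (Cardinal.mk_union_le _ _).trans_lt <| Cardinal.add_lt_of_lt h0.le
      ((hinj _ Sum.inr_injective).trans_lt hκ)
      (((Set.countable_range _).le_aleph0).trans_lt h0)
  have hmono : ∀ q ∈ 𝒮, StrictMono q.2 := by
    rintro q (⟨k, hk⟩ | ⟨p, rfl⟩)
    · have := hadm k
      rw [hk] at this
      exact this.1
    · exact strictMono_columnSeq _ _
  have hthin : ∀ q ∈ 𝒮, IsBranchThin q.2 := by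
    rintro q (⟨k, hk⟩ | ⟨p, rfl⟩)
    · have := hadm k
      rw [hk] at this
      exact this.2.1
    · exact isBranchThin_of_column_eq (strictMono_columnSeq _ _) (column_columnSeq _ _)
  have hres : ∀ q ∈ 𝒮, ConvergesOn 𝒰 q.1 q.2 := by
    rintro q hq U (⟨k, hk⟩ | ⟨l, rfl⟩)
    · rcases hq with ⟨k', hk'⟩ | ⟨p, rfl⟩
      · have := hcomp k k'
        rw [hk, hk'] at this
        exact this
      · have := hadm k
        rw [hk] at this
        exact this _ _
    · rcases hq with ⟨k', hk'⟩ | ⟨p, rfl⟩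
      · have := hadm k'
        rw [hk'] at this
        exact this.2.2 l
      · exact respects_testBit_columnSeq _ _ _
  have hbit : ∀ l, {z : ℕ | z.testBit l} ∈ 𝒰 := fun l => Or.inr ⟨l, rfl⟩
  have hset : ∀ W : Set ℕ, (∀ q ∈ 𝒮, Respects W q) →
      Addition.Admissible (.inl W) ∧ ∀ k, (a k).Compatible (.inl W) := by
    refine fun W hW => ⟨fun x c => hW _ (Or.inr ⟨(x, c), rfl⟩), fun k => ?_⟩
    rcases hk : a k with U | q
    · trivial
    · exact hW q (Or.inl ⟨k, hk⟩)
  rcases t with ⟨x, A⟩ | g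
  · by_cases hxA : x ∈ A
    · obtain ⟨h1, h2⟩ := hset univ fun q _ => .of_forall fun n => by simp
      exact ⟨_, ⟨h1, Or.inl hxA⟩, h2⟩
    rcases exists_separating_or_sequence h𝒰 h𝒮 hbit hmono hres hxA with
      ⟨W, hxW, hWA, hW⟩ | ⟨s, hs, hsthin, hsx, hsA⟩
    · obtain ⟨h1, h2⟩ := hset W hW
      exact ⟨_, ⟨h1, Or.inr (Or.inl ⟨W, rfl, hxW, hWA⟩)⟩, h2⟩
    · refine ⟨.inr (x, s), ⟨⟨hs, hsthin, fun l => hsx _ (hbit l)⟩,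
        Or.inr (Or.inr ⟨s, rfl, hsA⟩)⟩, fun k => ?_⟩
      rcases hk : a k with U | q
      · exact hsx U (Or.inl ⟨k, hk⟩)
      · trivial
  · obtain ⟨W, hne, hWy, hW⟩ := exists_set_above h𝒮 hmono hthin
      (fun q hq l => (hres q hq _ (hbit l)).mono fun n hn => Bool.eq_iff_iff.2 hn) g
    obtain ⟨h1, h2⟩ := hset W hW
    exact ⟨_, ⟨h1, W, rfl, hne, hWy⟩, h2⟩

theorem Addition.Compatible.symm {a b : Addition} (h : a.Compatible b) : b.Compatible a := by
  rcases a with U | q <;> rcases b with V | r <;> trivial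

theorem Addition.compatible_self (a : Addition) : a.Compatible a := by
  rcases a with U | q <;> trivial

theorem exists_space_of_boundingNumber_eq_continuum (hb : boundingNumber = 𝔠) :
    ∃ (X : Type) (_ : TopologicalSpace X),
      Countable X ∧ T2Space X ∧ IsZeroDimensional X ∧ FrechetUrysohnSpace X ∧
        ¬ HSeparable X ∧ piWeight X = boundingNumber := by
  let ι := (𝔠 : Cardinal.{0}).ord.ToType
  have hι : #ι = 𝔠 := Cardinal.mk_ord_toType _
  obtain ⟨task, htask⟩ : ∃ f : ι → (ℕ × Set ℕ) ⊕ (ℕ → ℕ), Function.Surjective f := by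
    have hle : #((ℕ × Set ℕ) ⊕ (ℕ → ℕ)) ≤ #ι := by
      rw [hι]
      simp
    obtain ⟨e⟩ := Cardinal.le_def _ _ |>.1 hle
    exact ⟨Function.invFun e, Function.invFun_surjective e.injective⟩
  obtain ⟨a, ha, hR⟩ := exists_transfinite_choice (ι := ι) Addition.Compatible
    (fun t b => b.Admissible ∧ b.Settles (task t)) fun t a h1 h2 => by
      obtain ⟨b, hb1, hb2⟩ := exists_addition (κ := Iio t)
        (by
          rw [hb]
          exact (Cardinal.mk_Iio_lt t (by rw [hι, Ordinal.type_toType])).trans_eq hι) (fun s => a s)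
        (fun s => (h1 s s.2).1) (fun r s => by
          rcases lt_trichotomy r s with h | h | h
          · exact h2 s s.2 r h
          · rw [h]
            exact Addition.compatible_self _
          · exact (h2 r r.2 s h).symm) (task t)
      exact ⟨b, hb1, fun s hs => hb2 ⟨s, hs⟩⟩
  have hcomp : ∀ r s, (a r).Compatible (a s) := by
    intro r s
    rcases lt_trichotomy r s with h | h | h
    · exact hR s r h
    · rw [h]
      exact Addition.compatible_self _
    · exact (hR r s h).symm
  let 𝒰 : Set (Set ℕ) := {U | ∃ t, a t = .inl U} ∪ range fun l => {z : ℕ | z.testBit l}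
  refine ⟨ℕ, clopenTopology_spec 𝒰 ?_ ?_ ?_ (fun c => {z | column z = c}) ?_ ?_⟩
  · rw [hb]
    exact (Cardinal.mk_set_le _).trans (by simp)
  · intro x y h
    refine Nat.eq_of_testBit_eq fun l => Bool.eq_iff_iff.2 (h _ (Or.inr ⟨l, rfl⟩))
  · intro x A hA
    obtain ⟨t, ht⟩ := htask (.inl (x, A))
    obtain ⟨hadm, hset⟩ := ha t
    rw [ht] at hset
    rcases hset with hxA | ⟨U, hU, hxU, hUA⟩ | ⟨s, hs, hsA⟩
    · exact ⟨fun _ => x, fun _ => hxA, fun _ _ => .of_forall fun _ => Iff.rfl⟩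
    · obtain ⟨z, hzA, hz⟩ := hA {U} (by
        rw [Finset.coe_singleton, singleton_subset_iff]
        exact Or.inl ⟨t, hU⟩)
      exact absurd hzA (disjoint_left.1 hUA ((hz U (by simp)).2 hxU))
    · refine ⟨s, hsA, ?_⟩
      rintro U (⟨t', hU⟩ | ⟨l, rfl⟩)
      · have := hcomp t' t
        rw [hU, hs] at this
        exact this
      · rw [hs] at hadm
        exact hadm.2.2 l
  · intro c x
    refine ⟨columnSeq x c, column_columnSeq x c, ?_⟩
    rintro U (⟨t, hU⟩ | ⟨l, rfl⟩)
    · have := (ha t).1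
      rw [hU] at this
      exact this x c
    · exact respects_testBit_columnSeq _ _ _
  · intro F hF
    choose g hg using fun c => (hF c).1.bddAbove
    obtain ⟨t, ht⟩ := htask (.inr g)
    obtain ⟨hadm, hset⟩ := ha t
    rw [ht] at hset
    obtain ⟨U, hU, hne, y, hy⟩ := hset
    refine ⟨U, Or.inl ⟨t, hU⟩, hne, branch y, infinite_branch y, fun c hc => ?_⟩
    refine disjoint_left.2 fun z hz hzU => ?_
    have h1 : column z = c := (hF c).2 hz
    have h2 := hy z hzU (h1 ▸ hc)
    rw [h1] at h2
    exact h2.not_ge (hg c hz)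

/-! ### Unbounded towers -/

theorem exists_monotone_ge (L : ℕ → ℕ) : ∃ M : ℕ → ℕ, Monotone M ∧ ∀ n, L n ≤ M n := by
  refine ⟨fun n => ∑ k ∈ Finset.range (n + 1), L k, monotone_nat_of_le_succ fun n => ?_,
    fun n => ?_⟩
  · rw [Finset.sum_range_succ _ (n + 1)]
    exact Nat.le_add_right _ _
  · exact Finset.single_le_sum (f := L) (fun _ _ => Nat.zero_le _) (Finset.self_mem_range_succ n)

theorem exists_finset_exhaustion {ι : Type} {C : Set ι} (hC : C.Countable) :
    ∃ Δ : ℕ → Finset ι, (∀ n, ∀ t ∈ Δ n, t ∈ C) ∧ ∀ t ∈ C, ∀ᶠ n in atTop, t ∈ Δ n := by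
  have := hC.to_subtype
  obtain ⟨e, he⟩ := exists_injective_nat C
  have hfin : ∀ n, (((↑) : C → ι) '' {i | e i ≤ n}).Finite := fun n =>
    ((Set.finite_Iic n).preimage he.injOn).image _
  refine ⟨fun n => (hfin n).toFinset, fun n t ht => ?_, fun t ht => ?_⟩
  · rw [Set.Finite.mem_toFinset] at ht
    obtain ⟨s, -, rfl⟩ := ht
    exact s.2
  · filter_upwards [eventually_ge_atTop (e ⟨t, ht⟩)] with n hn
    rw [Set.Finite.mem_toFinset]
    exact ⟨⟨t, ht⟩, hn, rfl⟩

/-- The range of `b` is almost contained in the range of `a`. -/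
def AlmostRefines (a b : ℕ → ℕ) : Prop := ∃ N, ∀ i, N ≤ b i → b i ∈ range a

theorem AlmostRefines.trans {a b c : ℕ → ℕ} (h : AlmostRefines a b) (h' : AlmostRefines b c) :
    AlmostRefines a c := by
  obtain ⟨N, hN⟩ := h
  obtain ⟨N', hN'⟩ := h'
  refine ⟨max N N', fun i hi => ?_⟩
  obtain ⟨j, hj⟩ := hN' i (le_of_max_le_right hi)
  rw [← hj]
  exact hN j (hj ▸ le_of_max_le_left hi)

section Tower

variable {ι : Type} [LinearOrder ι] [WellFoundedLT ι]

/-- A tower, each member of which has gaps larger than a prescribed function. -/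
theorem exists_tower (hι : ∀ t : ι, (Iio t).Countable) (f : ι → ℕ → ℕ) :
    ∃ e : ι → ℕ → ℕ, (∀ t, StrictMono (e t) ∧ ∀ i, f t (e t i) < e t (i + 1)) ∧
      ∀ t, ∀ s < t, AlmostRefines (e s) (e t) := by
  refine exists_transfinite_choice AlmostRefines
    (fun t a => StrictMono a ∧ ∀ i, f t (a i) < a (i + 1)) fun t a ha hR => ?_
  obtain ⟨Δ, hΔ, hΔt⟩ := exists_finset_exhaustion (hι t)
  have hfin : ∀ Γ : Finset ι, (∀ s ∈ Γ, s < t) → ∀ K, ∃ k, K < k ∧ ∀ s ∈ Γ, k ∈ range (a s) := by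
    intro Γ hΓ K
    rcases Γ.eq_empty_or_nonempty with rfl | hne
    · exact ⟨K + 1, by omega, by simp⟩
    -- The member with the largest index is almost contained in all the others, so its far values
    -- serve for all of `Γ`.
    have hm := hΓ _ (Γ.max'_mem hne)
    have h1 : ∀ s ∈ Γ, ∀ᶠ i in atTop, a (Γ.max' hne) i ∈ range (a s) := by
      intro s hs
      rcases (Γ.le_max' s hs).eq_or_lt with h | h
      · exact .of_forall fun i => ⟨i, by rw [← h]⟩
      · obtain ⟨N, hN⟩ := hR _ hm s h
        filter_upwards [(ha _ hm).1.tendsto_atTop.eventually_ge_atTop N] with i hi using hN i hi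
    obtain ⟨i, h2, h3⟩ := (((ha _ hm).1.tendsto_atTop.eventually_gt_atTop K).and
      ((Filter.eventually_all_finset Γ).2 h1)).exists
    exact ⟨_, h2, h3⟩
  choose pick hpick hpickm using fun n => hfin (Δ n) (hΔ n)
  let b : ℕ → ℕ := fun n => Nat.rec (pick 0 0) (fun n k => pick (n + 1) (max k (f t k))) n
  have hb : ∀ n, max (b n) (f t (b n)) < b (n + 1) := fun n => hpick _ _
  have hbm : ∀ n, ∀ s ∈ Δ n, b n ∈ range (a s) := by
    rintro (_ | n)
    · exact hpickm _ _
    · exact hpickm _ _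
  have hmono : StrictMono b := strictMono_nat_of_lt_succ fun n =>
    (le_max_left _ _).trans_lt (hb n)
  refine ⟨b, ⟨hmono, fun i => (le_max_right _ _).trans_lt (hb i)⟩, fun s hs => ?_⟩
  obtain ⟨N, hN⟩ := eventually_atTop.1 (hΔt s hs)
  exact ⟨b N, fun i hi => hbm i s (hN i (hmono.le_iff_le.1 hi))⟩

end Tower

/-- The interval `[K, L)` contains no value of `e`. -/
def IsGap (e : ℕ → ℕ) (K L : ℕ) : Prop := ∀ i, ¬ (K ≤ e i ∧ e i < L)

theorem exists_frequently_isGap {ι : Type} {f e : ι → ℕ → ℕ} (hf : ∀ t, Monotone (f t))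
    (hfu : ∀ g : ℕ → ℕ, ∃ t, ∃ᶠ n in atTop, g n < f t n) (he : ∀ t, StrictMono (e t))
    (hfe : ∀ t i, f t (e t i) < e t (i + 1)) (L : ℕ → ℕ) :
    ∃ t, ∃ᶠ K in atTop, IsGap (e t) K (L K) := by
  obtain ⟨M, hM, hLM⟩ := exists_monotone_ge L
  obtain ⟨t, ht⟩ := hfu fun n => M (M n)
  -- Without such gaps, two consecutive applications put two values of `e t` between `n` and `M (M
  -- n)`. Then `f t n` lies below the second of them, so `M ∘ M` would dominate `f t`.
  refine ⟨t, fun hev => ht ?_⟩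
  obtain ⟨N, hN⟩ := eventually_atTop.1 hev
  filter_upwards [eventually_ge_atTop N] with n hn hlt
  have h1 : ∀ K ≥ N, ∃ i, K ≤ e t i ∧ e t i < M K := by
    intro K hK
    obtain ⟨i, hi⟩ := not_forall.1 (hN K hK)
    exact ⟨i, (not_not.1 hi).1, (not_not.1 hi).2.trans_le (hLM K)⟩
  obtain ⟨i, hi1, hi2⟩ := h1 n hn
  obtain ⟨j, hj1, hj2⟩ := h1 (e t i + 1) (by omega)
  have hij : i + 1 ≤ j := (he t).lt_iff_lt.1 (by omega)
  have h2 := hf t hi1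
  have h3 := hfe t i
  have h4 := (he t).monotone hij
  have h5 := hM (show e t i + 1 ≤ M n from hi2)
  omega

theorem exists_frequently_le_skip {ι : Type} {f e : ι → ℕ → ℕ} (hf : ∀ t, Monotone (f t))
    (hfu : ∀ g : ℕ → ℕ, ∃ t, ∃ᶠ n in atTop, g n < f t n) (he : ∀ t, StrictMono (e t))
    (hfe : ∀ t i, f t (e t i) < e t (i + 1)) (g : ℕ → ℕ) :
    ∃ t, ∃ᶠ i in atTop, g (e t i) ≤ e t (i + 2) := by
  obtain ⟨M, hM, hgM⟩ := exists_monotone_ge g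
  obtain ⟨t, ht⟩ := hfu M
  refine ⟨t, fun hev => ht ?_⟩
  obtain ⟨N, hN⟩ := eventually_atTop.1 hev
  filter_upwards [eventually_gt_atTop (e t N)] with n hn hlt
  -- With `e t j < n ≤ e t (j + 1)`, one has `f t n < e t (j + 2) < g (e t j) ≤ M n`. This is why
  -- `IsBelow` skips two places.
  have hex : ∃ i, n ≤ e t i := ⟨n, (he t).le_apply⟩
  have h1 := Nat.find_spec hex
  have h2 : N < Nat.find hex := by
    by_contra! h
    have := (he t).monotone h
    omega
  obtain ⟨j, hj⟩ : ∃ j, Nat.find hex = j + 1 := ⟨Nat.find hex - 1, by omega⟩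
  have h3 := Nat.find_min hex (m := j) (by omega)
  rw [hj] at h1
  have h4 := hf t h1
  have h5 : f t (e t (j + 1)) < e t (j + 2) := hfe t (j + 1)
  have h6 := hN j (by omega)
  have h7 := hgM (e t j)
  have h8 := hM (show e t j ≤ n by omega)
  omega

/-! ### Clopen sets of finite sets -/

/-- `z` lies below the partial function `e i ↦ e (i + 2)`. -/
def IsBelow (e : ℕ → ℕ) (z : ℕ) : Prop := ∃ i, (Nat.unpair z).1 = e i ∧ z ≤ e (i + 2)

/-- The finite sets whose maximum in each interval between successive values of `e` is not
below the partial function given by `e`. -/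
def avoiding (e : ℕ → ℕ) : Set (Finset ℕ) :=
  {a | ∀ z ∈ a, IsBelow e z → ∃ w ∈ a, z < w ∧ ∀ i, ¬ (z < e i ∧ e i ≤ w)}

/-- A value of `e` beyond `x` and not above any element of `b` ensures that no witness for one part
comes from the other. -/
theorem eventually_union_mem_avoiding_iff {e : ℕ → ℕ} (he : StrictMono e) (x : Finset ℕ) :
    ∃ N, ∀ b : Finset ℕ, (∀ z ∈ b, N ≤ z) →
      (x ∪ b ∈ avoiding e ↔ x ∈ avoiding e ∧ b ∈ avoiding e) := by
  set i := x.sup id + 1 with hi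
  have hx : ∀ z ∈ x, z < e i := fun z hz => by
    have h1 : z ≤ x.sup id := Finset.le_sup (f := id) hz
    have h2 : i ≤ e i := he.le_apply
    omega
  refine ⟨e i, fun b hb => ⟨fun h => ⟨fun z hz hzb => ?_, fun z hz hzb => ?_⟩, ?_⟩⟩
  · obtain ⟨w, hw, hzw, hgap⟩ := h z (Finset.mem_union_left _ hz) hzb
    rcases Finset.mem_union.1 hw with hw | hw
    · exact ⟨w, hw, hzw, hgap⟩
    · exact absurd ⟨hx z hz, hb w hw⟩ (hgap i)
  · obtain ⟨w, hw, hzw, hgap⟩ := h z (Finset.mem_union_right _ hz) hzb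
    rcases Finset.mem_union.1 hw with hw | hw
    · have h1 := hx w hw
      have h2 := hb z hz
      omega
    · exact ⟨w, hw, hzw, hgap⟩
  · rintro ⟨h1, h2⟩ z hz hzb
    rcases Finset.mem_union.1 hz with hz | hz
    · obtain ⟨w, hw, h⟩ := h1 z hz hzb
      exact ⟨w, Finset.mem_union_left _ hw, h⟩
    · obtain ⟨w, hw, h⟩ := h2 z hz hzb
      exact ⟨w, Finset.mem_union_right _ hw, h⟩

theorem exists_not_isBelow {e : ℕ → ℕ} (he : StrictMono e) (m : ℕ) :
    ∃ N, ∀ z, N ≤ z → (Nat.unpair z).1 = m → ¬ IsBelow e z := by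
  by_cases hm : ∃ i, m = e i
  · obtain ⟨i, rfl⟩ := hm
    refine ⟨e (i + 2) + 1, fun z hz hzm ⟨j, hj, hzj⟩ => ?_⟩
    have : i = j := he.injective (hzm.symm.trans hj)
    subst this
    omega
  · exact ⟨0, fun z _ hzm ⟨j, hj, _⟩ => hm ⟨j, hzm.symm.trans hj⟩⟩

/-- The largest element of `b` lies in column `m` or beyond column `K`. -/
def HasColumn (m K : ℕ) (b : Finset ℕ) : Prop :=
  ∃ z ∈ b, (∀ w ∈ b, w ≤ z) ∧ ((Nat.unpair z).1 = m ∨ K ≤ (Nat.unpair z).1)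

/-- PLACEHOLDER -/
theorem eventually_mem_avoiding_of_isGap {e : ℕ → ℕ} (he : StrictMono e) (m : ℕ) :
    ∃ N, ∀ K ≥ N, ∀ L, IsGap e K L → ∀ b : Finset ℕ, (∀ z ∈ b, K ≤ z ∧ z < L) →
      HasColumn m K b → b ∈ avoiding e := by
  obtain ⟨N, hN⟩ := exists_not_isBelow he m
  refine ⟨N, fun K hK L hgap b hb ⟨z, hz, hmax, hcol⟩ w hw hwb => ?_⟩
  have hzb : ¬ IsBelow e z := by
    rcases hcol with h | h
    · exact hN z (hK.trans (hb z hz).1) h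
    · rintro ⟨i, hi, -⟩
      have h1 := Nat.unpair_left_le z
      have h2 := (hb z hz).2
      exact hgap i ⟨hi ▸ h, by omega⟩
  refine ⟨z, hz, lt_of_le_of_ne (hmax w hw) fun h => hzb (h ▸ hwb), fun i hi => hgap i ?_⟩
  have h1 := (hb w hw).1
  have h2 := (hb z hz).2
  omega

/-! ### The construction for `𝔟 = ℵ₁` -/

/-- If `B` contains finite sets arbitrarily far out that avoid finitely many given members of the
tower, it contains a sequence moving off to infinity that eventually avoids each of them. -/
theorem exists_convergent_sequence {ι : Type} [LinearOrder ι] [WellFoundedLT ι]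
    (hι : ∀ t : ι, (Iio t).Countable) (hbd : ∀ d : ℕ → ι, ∃ t, ∀ i, d i < t)
    {e : ι → ℕ → ℕ} (he : ∀ t, StrictMono (e t))
    (htower : ∀ t, ∀ s < t, AlmostRefines (e s) (e t))
    (hgap : ∀ L : ℕ → ℕ, ∃ t, ∃ᶠ K in atTop, IsGap (e t) K (L K))
    {T : Set ι} {B : Set (Finset ℕ)} {m : ℕ}
    (hB : ∀ (K : ℕ) (Δ : Finset ι), (∀ t ∈ Δ, t ∈ T) →
      ∃ b ∈ B, (∀ z ∈ b, K ≤ z) ∧ HasColumn m K b ∧ ∀ t ∈ Δ, b ∈ avoiding (e t)) :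
    ∃ b : ℕ → Finset ℕ, (∀ n, b n ∈ B) ∧ (∀ n, ∀ z ∈ b n, n ≤ z) ∧
      ∀ t ∈ T, ∀ᶠ n in atTop, b n ∈ avoiding (e t) := by
  choose Δ hΔ hΔt using fun δ : ι =>
    exists_finset_exhaustion (C := T ∩ Iio δ) ((hι δ).mono inter_subset_right)
  choose b hbB hbK hbcol hbΔ using fun δ K => hB K (Δ δ K) fun t ht => (hΔ δ K t ht).1
  choose γ hγ using fun δ => hgap fun K => (b δ K).sup id + 1
  have hnext : ∀ δ : ι, ∃ δ', δ < δ' ∧ γ δ < δ' := fun δ => by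
    obtain ⟨t, ht⟩ := hbd fun n => if n = 0 then δ else γ δ
    exact ⟨t, by simpa using ht 0, by simpa using ht 1⟩
  choose next hnext₁ hnext₂ using hnext
  obtain ⟨δ₀, -⟩ := hgap id
  let d : ℕ → ι := fun n => next^[n] δ₀
  have hd : ∀ n, d (n + 1) = next (d n) := fun n => Function.iterate_succ_apply' _ _ _
  have hdm : StrictMono d := strictMono_nat_of_lt_succ fun n => by
    rw [hd]
    exact hnext₁ _
  obtain ⟨δ, hδ, hδmin⟩ : ∃ δ, (∀ i, d i < δ) ∧ ∀ t < δ, ∃ i, t < d i := by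
    let S : Set ι := {t | ∀ i, d i < t}
    have hS : S.Nonempty := hbd d
    refine ⟨wellFounded_lt.min S hS, wellFounded_lt.min_mem S hS, fun t ht => ?_⟩
    have h1 : t ∉ S := fun h => wellFounded_lt.not_lt_min S h ht
    obtain ⟨i, hi⟩ := not_forall.1 h1
    exact ⟨i + 1, (not_lt.1 hi).trans_lt (hdm (Nat.lt_succ_self i))⟩
  have hrefine : ∀ {s t : ι}, s ≤ t → AlmostRefines (e s) (e t) := by
    intro s t h
    rcases h.eq_or_lt with rfl | h
    · exact ⟨0, fun i _ => mem_range_self i⟩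
    · exact htower t s h
  have hrgap : ∀ {s t : ι}, s ≤ t → ∃ N, ∀ K ≥ N, ∀ L, IsGap (e s) K L → IsGap (e t) K L := by
    intro s t h
    obtain ⟨N, hN⟩ := hrefine h
    refine ⟨N, fun K hK L hg i hi => ?_⟩
    obtain ⟨j, hj⟩ := hN i (hK.trans hi.1)
    exact hg j (hj ▸ hi)
  have hex : ∀ i, ∃ K, i ≤ K ∧ IsGap (e δ) K ((b (d i) K).sup id + 1) ∧
      ∀ t ∈ (Δ δ i).filter (· < d i), b (d i) K ∈ avoiding (e t) := by
    intro i
    obtain ⟨N, hN⟩ := hrgap (s := γ (d i)) (t := δ)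
      ((hnext₂ (d i)).trans (by rw [← hd]; exact hδ _)).le
    have h1 : ∀ᶠ K in atTop, ∀ t ∈ (Δ δ i).filter (· < d i), b (d i) K ∈ avoiding (e t) := by
      refine (Filter.eventually_all_finset _).2 fun t ht => ?_
      rw [Finset.mem_filter] at ht
      filter_upwards [hΔt (d i) t ⟨(hΔ δ i t ht.1).1, ht.2⟩] with K hK using hbΔ _ _ t hK
    obtain ⟨K, hK, hK1, hK2⟩ := ((hγ (d i)).and_eventually
      (h1.and (eventually_ge_atTop (max i N)))).exists
    exact ⟨K, le_of_max_le_left hK2, hN K (le_of_max_le_right hK2) _ hK, hK1⟩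
  choose K hiK hKgap hKΔ using hex
  refine ⟨fun i => b (d i) (K i), fun i => hbB _ _, fun i z hz => (hiK i).trans (hbK _ _ z hz),
    fun t ht => ?_⟩
  rcases lt_or_ge t δ with htδ | htδ
  · obtain ⟨j, hj⟩ := hδmin t htδ
    filter_upwards [hΔt δ t ⟨ht, htδ⟩, eventually_ge_atTop j] with i hi hij
    exact hKΔ i t (Finset.mem_filter.2 ⟨hi, hj.trans_le (hdm.monotone hij)⟩)
  · obtain ⟨N, hN⟩ := hrgap htδ
    obtain ⟨N', hN'⟩ := eventually_mem_avoiding_of_isGap (he t) m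
    filter_upwards [eventually_ge_atTop (max N N')] with i hi
    refine hN' (K i) ((le_of_max_le_right hi).trans (hiK i)) _
      (hN (K i) ((le_of_max_le_left hi).trans (hiK i)) _ (hKgap i)) _ (fun z hz => ⟨?_, ?_⟩)
      (hbcol _ _)
    · exact hbK _ _ z hz
    · exact Nat.lt_succ_of_le (Finset.le_sup (f := id) hz)

theorem exists_space_of_boundingNumber_eq_aleph_one (hb : boundingNumber = ℵ_ 1) :
    ∃ (X : Type) (_ : TopologicalSpace X),
      Countable X ∧ T2Space X ∧ IsZeroDimensional X ∧ FrechetUrysohnSpace X ∧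
        ¬ HSeparable X ∧ piWeight X = boundingNumber := by
  classical
  let ι := (ℵ_ 1 : Cardinal.{0}).ord.ToType
  have hcard : #ι = ℵ_ 1 := Cardinal.mk_ord_toType _
  have hι : ∀ t : ι, (Iio t).Countable := by
    intro t
    rw [← Cardinal.le_aleph0_iff_set_countable, ← Cardinal.lt_aleph_one_iff]
    exact (Cardinal.mk_Iio_lt t (by rw [hcard, Ordinal.type_toType])).trans_eq hcard
  have hbd : ∀ d : ℕ → ι, ∃ t, ∀ i, d i < t := by
    intro d
    by_contra! hcon
    have h1 : (univ : Set ι).Countable := by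
      refine (countable_iUnion fun i => ((hι (d i)).insert (d i))).mono fun t _ => ?_
      obtain ⟨i, hi⟩ := hcon t
      exact mem_iUnion.2 ⟨i, hi.eq_or_lt.imp id id⟩
    rw [← Cardinal.le_aleph0_iff_set_countable, Cardinal.mk_univ, hcard,
      ← Cardinal.lt_aleph_one_iff] at h1
    exact lt_irrefl _ h1
  obtain ⟨F, hF, hFc⟩ := exists_unboundedModFinite_card_eq
  obtain ⟨φ⟩ : Nonempty (ι ≃ F) := Cardinal.eq.1 (by rw [hcard, hFc, hb])
  choose f hf hφf using fun t => exists_monotone_ge (φ t : ℕ → ℕ)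
  have hfu : ∀ g : ℕ → ℕ, ∃ t, ∃ᶠ n in atTop, g n < f t n := by
    intro g
    by_contra! hcon
    refine hF ⟨g, fun h hh => ?_⟩
    obtain ⟨t, ht⟩ := φ.surjective ⟨h, hh⟩
    filter_upwards [hcon t] with n hn
    have h1 := hφf t n
    rw [ht] at h1
    exact h1.trans hn
  obtain ⟨e, hef, htower⟩ := exists_tower hι f
  have he := fun t => (hef t).1
  have hgap := exists_frequently_isGap hf hfu he fun t => (hef t).2
  have hskip := exists_frequently_le_skip hf hfu he fun t => (hef t).2
  let 𝒰 : Set (Set (Finset ℕ)) := range (fun t => avoiding (e t)) ∪ range fun z : ℕ => {a | z ∈ a}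
  have hconv : ∀ (x : Finset ℕ) (b : ℕ → Finset ℕ), (∀ n, ∀ z ∈ b n, n ≤ z) →
      (∀ t, x ∈ avoiding (e t) → ∀ᶠ n in atTop, b n ∈ avoiding (e t)) →
      ConvergesOn 𝒰 x fun n => x ∪ b n := by
    rintro x b hbn hb _ (⟨t, rfl⟩ | ⟨z, rfl⟩)
    · obtain ⟨N, hN⟩ := eventually_union_mem_avoiding_iff (he t) x
      by_cases hx : x ∈ avoiding (e t)
      · filter_upwards [hb t hx, eventually_ge_atTop N] with n hn hnN
        rw [hN _ fun z hz => hnN.trans (hbn n z hz)]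
        exact and_iff_left hn
      · filter_upwards [eventually_ge_atTop N] with n hnN
        rw [hN _ fun z hz => hnN.trans (hbn n z hz)]
        exact and_iff_left_of_imp fun h => absurd h hx
    · filter_upwards [eventually_gt_atTop z] with n hn
      have : z ∉ b n := fun h => (hbn n z h).not_gt hn
      simp [this]
  refine ⟨Finset ℕ, clopenTopology_spec 𝒰 ?_ ?_ ?_
    (fun m => {a | ∃ z ∈ a, (∀ w ∈ a, w ≤ z) ∧ (Nat.unpair z).1 = m}) ?_ ?_⟩
  · refine (Cardinal.mk_union_le _ _).trans
      (Cardinal.add_le_of_le aleph0_lt_boundingNumber.le ?_ ?_)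
    · exact Cardinal.mk_range_le.trans (by rw [hcard, hb])
    · exact ((Set.countable_range _).le_aleph0).trans aleph0_lt_boundingNumber.le
  · intro x y h
    ext z
    exact h _ (Or.inr ⟨z, rfl⟩)
  · intro x A hA
    by_cases hxA : x ∈ A
    · exact ⟨fun _ => x, fun _ => hxA, fun _ _ => .of_forall fun _ => Iff.rfl⟩
    let T : Set ι := {t | x ∈ avoiding (e t)}
    let B : Set (Finset ℕ) := {b | x ∪ b ∈ A}
    have happrox : ∀ (K : ℕ) (Δ : Finset ι), (∀ t ∈ Δ, t ∈ T) → ∃ b ∈ B, b.Nonempty ∧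
        (∀ z ∈ b, K ≤ z) ∧ ∀ t ∈ Δ, b ∈ avoiding (e t) := by
      intro K Δ hΔ
      choose N hN using fun t => eventually_union_mem_avoiding_iff (he t) x
      set M := max K (max (Δ.sup N) (x.sup id + 1)) with hM
      have hKM : K ≤ M := le_max_left _ _
      have hNM : ∀ t ∈ Δ, N t ≤ M := fun t ht =>
        (Finset.le_sup ht).trans ((le_max_left _ _).trans (le_max_right _ _))
      have hxM : ∀ z ∈ x, z < M := fun z hz => by
        have h1 : z ≤ x.sup id := Finset.le_sup (f := id) hz
        have h2 : x.sup id + 1 ≤ M := (le_max_right _ _).trans (le_max_right _ _)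
        omega
      obtain ⟨a, haA, ha⟩ := hA (Δ.image (fun t => avoiding (e t)) ∪
        (Finset.range M).image fun z : ℕ => {a : Finset ℕ | z ∈ a}) (by
          intro U hU
          rcases Finset.mem_union.1 (Finset.mem_coe.1 hU) with h | h
          · obtain ⟨t, -, rfl⟩ := Finset.mem_image.1 h
            exact Or.inl ⟨t, rfl⟩
          · obtain ⟨z, -, rfl⟩ := Finset.mem_image.1 h
            exact Or.inr ⟨z, rfl⟩)
      have hlow : ∀ z < M, (z ∈ a ↔ z ∈ x) := fun z hz =>
        ha _ (Finset.mem_union_right _ (Finset.mem_image_of_mem _ (Finset.mem_range.2 hz)))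
      have hxa : x ∪ (a \ x) = a :=
        Finset.union_sdiff_of_subset fun z hz => (hlow z (hxM z hz)).2 hz
      have hge : ∀ z ∈ a \ x, M ≤ z := by
        intro z hz
        rw [Finset.mem_sdiff] at hz
        by_contra! hlt
        exact hz.2 ((hlow z hlt).1 hz.1)
      refine ⟨a \ x, ?_, ?_, fun z hz => hKM.trans (hge z hz), fun t ht => ?_⟩
      · change x ∪ (a \ x) ∈ A
        rwa [hxa]
      · rw [Finset.nonempty_iff_ne_empty]
        intro h0
        rw [h0, Finset.union_empty] at hxa
        exact hxA (hxa ▸ haA)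
      · refine ((hN t _ fun z hz => (hNM t ht).trans (hge z hz)).1 ?_).2
        rw [hxa]
        exact (ha _ (Finset.mem_union_left _ (Finset.mem_image_of_mem _ ht))).2 (hΔ t ht)
    obtain ⟨m, hm⟩ : ∃ m, ∀ (K : ℕ) (Δ : Finset ι), (∀ t ∈ Δ, t ∈ T) → ∃ b ∈ B,
        (∀ z ∈ b, K ≤ z) ∧ HasColumn m K b ∧ ∀ t ∈ Δ, b ∈ avoiding (e t) := by
      by_contra! hcon
      choose K Δ hΔ hbad using hcon
      obtain ⟨b, hbB, hne, hbK, hbΔ⟩ := happrox ((Finset.range (K 0 + 1)).sup K)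
        ((Finset.range (K 0 + 1)).biUnion Δ) (fun t ht => by
          obtain ⟨i, -, hi⟩ := Finset.mem_biUnion.1 ht
          exact hΔ i t hi)
      have hcol : ∀ m ≤ K 0, ¬ HasColumn m (K m) b := by
        intro m hm hcol
        have hmr : m ∈ Finset.range (K 0 + 1) := Finset.mem_range.2 (by omega)
        obtain ⟨t, ht, htb⟩ := hbad m b hbB
          (fun z hz => (Finset.le_sup (f := K) hmr).trans (hbK z hz)) hcol
        exact htb (hbΔ t (Finset.mem_biUnion.2 ⟨m, hmr, ht⟩))
      have hz := b.max'_mem hne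
      have hmax : ∀ w ∈ b, w ≤ b.max' hne := fun w hw => b.le_max' w hw
      rcases le_or_gt (Nat.unpair (b.max' hne)).1 (K 0) with h | h
      · exact hcol _ h ⟨_, hz, hmax, Or.inl rfl⟩
      · exact hcol 0 (Nat.zero_le _) ⟨_, hz, hmax, Or.inr h.le⟩
    obtain ⟨b, hbB, hbn, hbT⟩ := exists_convergent_sequence hι hbd he htower hgap hm
    exact ⟨fun n => x ∪ b n, hbB, hconv x b hbn hbT⟩
  · intro m x
    let v : ℕ → ℕ := fun n => Nat.pair m (n + x.sup id + 1)
    have hv : ∀ n, n + x.sup id + 1 ≤ v n := fun n => Nat.right_le_pair _ _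
    refine ⟨fun n => x ∪ {v n}, fun n => ⟨v n, by simp, fun w hw => ?_, by simp [v]⟩,
      hconv x _ (fun n z hz => ?_) fun t _ => ?_⟩
    · have := hv n
      rcases Finset.mem_union.1 hw with h | h
      · have h1 : w ≤ x.sup id := Finset.le_sup (f := id) h
        omega
      · exact (Finset.mem_singleton.1 h).le
    · have := hv n
      rw [Finset.mem_singleton.1 hz]
      omega
    · obtain ⟨N, hN⟩ := exists_not_isBelow (he t) m
      filter_upwards [eventually_ge_atTop N] with n hn z hz hzb
      have := hv n
      rw [Finset.mem_singleton.1 hz] at hzb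
      exact absurd hzb (hN _ (by omega) (by simp [v]))
  · intro F hF
    have hbound : ∀ m, ∃ g, ∀ a ∈ F m, ∀ z ∈ a, z ≤ g := by
      intro m
      obtain ⟨g, hg⟩ := ((hF m).1.biUnion fun a _ => a.finite_toSet).bddAbove
      exact ⟨g, fun a ha z hz => hg (mem_iUnion₂.2 ⟨a, ha, hz⟩)⟩
    choose g hg using hbound
    obtain ⟨t, ht⟩ := hskip g
    refine ⟨avoiding (e t), Or.inl ⟨t, rfl⟩, ⟨∅, by simp [avoiding]⟩,
      e t '' {i | g (e t i) ≤ e t (i + 2)},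
      (Nat.frequently_atTop_iff_infinite.1 ht).image (he t).injective.injOn, ?_⟩
    rintro _ ⟨i, hi, rfl⟩
    refine disjoint_left.2 fun a ha hat => ?_
    obtain ⟨z, hz, hmax, hcol⟩ := (hF _).2 ha
    obtain ⟨w, hw, hzw, -⟩ := hat z hz ⟨i, hcol, (hg _ a ha z hz).trans hi⟩
    exact (hmax w hw).not_gt hzw

theorem corollary1p4 (hc : Cardinal.continuum.{0} ≤ ℵ_ 2) :
    ∃ (X : Type) (_ : TopologicalSpace X),
      Countable X ∧ T2Space X ∧ IsZeroDimensional X ∧ FrechetUrysohnSpace X ∧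
        ¬ HSeparable X ∧ piWeight X = boundingNumber := by
  have h1 : ℵ_ 1 ≤ boundingNumber := by
    rw [← Cardinal.succ_aleph0]
    exact Order.succ_le_of_lt aleph0_lt_boundingNumber
  rcases h1.eq_or_lt with h | h
  · exact exists_space_of_boundingNumber_eq_aleph_one h.symm
  · have h2 : ℵ_ 2 ≤ boundingNumber := by
      have h3 : (ℵ_ 2 : Cardinal.{0}) = Order.succ (ℵ_ 1) := by
        rw [Cardinal.succ_aleph]
        congr 1
        exact one_add_one_eq_two.symm
      rw [h3]
      exact Order.succ_le_of_lt h
    exact exists_space_of_boundingNumber_eq_continuum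
      (boundingNumber_le_continuum.antisymm (hc.trans h2))
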